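/- Let $K=\mathbb{F}_q$ be a finite field, $\mathcal Y$ a finite set, and let $W:K\to\mathcal Y$ be a discrete memoryless channel with transition probabilities $W(y\mid x)$ that is symmetric over the field: for every $a\in K$ there is a permutation $\sigma_a$ of $\mathcal Y$ with $W(y\mid x)=W(\sigma_a(y)\mid x+a)$, and for every $a\in K\setminus\{0\}$ there is a permutation $\psi_a$ of $\mathcal Y$ with $W(y\mid x)=W(\psi_a(y)\mid ax)$, for all $x,y$. Let $S_1,\dots,S_m\subseteq K$, $n_k=|S_k|$, $n=\prod_k n_k$. For $S=\{a_1,\dots,a_l\}$ (in any enumeration) let $T(S)\in K^{l\times l}$ be the matrix whose rows are the evaluations of $x^{l-1},\dots,x,1$ at $a_1,\dots,a_l$. Let $G_m$ be the matrix obtained from $T(S_1)\otimes\cdots\otimes T(S_m)$ by ordering its rows so that the row with digits $(k_1,\dots,k_m)$, $0\le k_i<n_i$, has number $k_1+\sum_{i\ge2}k_i\,n_1\cdots n_{i-1}$ (counting from $0$). This row is the vector of values on $S_1\times\cdots\times S_m$ of the monomial $x_1^{n_1-1-k_1}\cdots x_m^{n_m-1-k_m}$; in this way the row indices $1,\dots,n$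 are identified with the monomials $x_1^{a_1}\cdots x_m^{a_m}$, $0\le a_i\le n_i-1$. For $1\le i\le n$ let $W_m^{(i)}$ be the synthetic channel $$W_m^{(i)}(y_1^n,u_1^{i-1}\mid u_i)=\frac1{q^{n-1}}\sum_{u_{i+1},\dots,u_n\in K}\ \prod_{j=1}^n W\big(y_j\mid (uG_m)_j\big),$$ and for a channel $V$ with input alphabet $K$ let $Z(V)=\frac1{q(q-1)}\sum_{x\ne x'}\sum_y\sqrt{V(y\mid x)V(y\mid x')}$. Write $Z(M)=Z(W_m^{(i)})$ if $M$ is the monomial of row $i$. An information set is a set $\mathcal A_m\subseteq\{1,\dots,n\}$ such that $Z(W_m^{(i)})\le Z(W_m^{(j)})$ for all $i\in\mathcal A_m$ and $j\notin\mathcal A_m$; view it as a set of monomials. Let $\trianglelefteq$ be the smallest transitive relation on the monomials in $x_1,\dots,x_m$ such that: (i) if $M'\mid M$ then $M'\trianglelefteq M$; (ii) if $j_1<\cdots<j_s$ and $h_1<\cdots<h_s$ are indices such that all the sets $S_{j_t}$, $S_{h_t}$ are equal and $j_t\le h_t$ for all $t$, then $x_{j_1}^{a_1}\cdots x_{j_s}^{a_s}\trianglelefteq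 x_{h_1}^{a_1}\cdots x_{h_s}^{a_s}$ for all $a_1,\dots,a_s\ge 0$; (iii) if $1\le k\le m-1$, $M,M'$ are monomials in $x_1,\dots,x_k$, and $\tilde M,\tilde M'$ are monomials in $x_{k+1},\dots,x_m$ with $M\trianglelefteq M'$ and $\tilde M\trianglelefteq\tilde M'$, then $M\tilde M\trianglelefteq M'\tilde M'$. Then every information set $\mathcal A_m$ is closed under $\trianglelefteq$ up to ties of the Bhattacharyya parameter: if $M\in\mathcal A_m$, $M'\trianglelefteq M$ and $Z(M')\ne Z(M)$, then $M'\in\mathcal A_m$. -/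

import Mathlib

open scoped BigOperators Matrix

namespace PolarCode

noncomputable section

/-- `W x y = W(y|x)` are the transition probabilities of a discrete memoryless channel with input
alphabet `X` and finite output alphabet `Y`. -/
def IsChannel {X Y : Type*} [Fintype Y] (W : X → Y → ℝ) : Prop :=
  (∀ x y, 0 ≤ W x y) ∧ ∀ x, ∑ y, W x y = 1

/-- Symmetric over the sum: for each `a` there is a permutation `σ` of the outputs with
`W(y|x) = W(σ y|x + a)`. -/
def SymmetricOverSum {K Y : Type*} [Field K] (W : K → Y → ℝ) : Prop :=
  ∀ a : K, ∃ σ : Equiv.Perm Y, ∀ x y, W x y = W (x + a) (σ y)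

/-- Symmetric over the product: for each `a ≠ 0` there is a permutation `ψ` of the outputs with
`W(y|x) = W(ψ y|a x)`. -/
def SymmetricOverProduct {K Y : Type*} [Field K] (W : K → Y → ℝ) : Prop :=
  ∀ a : K, a ≠ 0 → ∃ ψ : Equiv.Perm Y, ∀ x y, W x y = W (a * x) (ψ y)

/-- Symmetric over the field (SOF). -/
def SymmetricOverField {K Y : Type*} [Field K] (W : K → Y → ℝ) : Prop :=
  SymmetricOverSum W ∧ SymmetricOverProduct W

/-- The Bhattacharyya distance `Z(x, x')`. -/
def bhattacharyyaDist {X Y : Type*} [Fintype Y] (W : X → Y → ℝ) (x x' : X) : ℝ :=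
  ∑ y, Real.sqrt (W x y * W x' y)

/-- The Bhattacharyya parameter `Z(W)`: the average of `Z(x, x')` over ordered pairs `x ≠ x'`. -/
def bhattacharyya {X Y : Type*} [Fintype X] [DecidableEq X] [Fintype Y] (W : X → Y → ℝ) : ℝ :=
  1 / ((Fintype.card X : ℝ) * ((Fintype.card X : ℝ) - 1)) *
    ∑ p : X × X with p.1 ≠ p.2, bhattacharyyaDist W p.1 p.2

/-- The matrix `G_m` of a family of kernels `T_1, …, T_m`: the Kronecker product
`T_1 ⊗ ⋯ ⊗ T_m`, with its rows rearranged so that the row with digits `(k_1, …, k_m)` is row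
number `k_1 + k_2 n_1 + k_3 n_1 n_2 + ⋯` (counting from zero; the digit of `T_m` is the most
significant one). The columns stay indexed by their tuples of digits. -/
def polarMatrix {K : Type*} [Field K] {m : ℕ} {n : Fin m → ℕ}
    (T : ∀ k, Matrix (Fin (n k)) (Fin (n k)) K) :
    Matrix (Fin (∏ k, n k)) (∀ k, Fin (n k)) K :=
  (Matrix.of fun (r c : ∀ k, Fin (n k)) => ∏ k, T k (r k) (c k)).submatrix
    finPiFinEquiv.symm id

/-- The synthetic channel `W^{(i)}` defined by a matrix `G` with `N` rows and columns indexed by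
`ι`. The input is `u_i`, the output is the channel output `y` together with all earlier inputs
`(u_j)_{j < i}`, and the later inputs are summed over:
`W^{(i)}(y, (u_j)_{j<i} | u_i) = q^{-(N-1)} ∑_{(u_j)_{j>i}} ∏_c W(y_c | (u G)_c)`. -/
def synthChannel {K Y ι : Type*} [Field K] [Fintype K] [DecidableEq K] [Fintype ι] {N : ℕ}
    (W : K → Y → ℝ) (G : Matrix (Fin N) ι K) (i : Fin N) :
    K → ((ι → Y) × ({j : Fin N // j < i} → K)) → ℝ :=
  fun x o => 1 / (Fintype.card K : ℝ) ^ (N - 1) *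
    ∑ u : Fin N → K with u i = x ∧ ∀ j : {j : Fin N // j < i}, u j = o.2 j,
      ∏ c, W ((u ᵥ* G) c) (o.1 c)

/-- The Bhattacharyya parameter of the `i`-th synthetic channel. -/
def synthBhattacharyya {K Y ι : Type*} [Field K] [Fintype K] [DecidableEq K] [Fintype Y]
    [Fintype ι] [DecidableEq ι] {N : ℕ} (W : K → Y → ℝ) (G : Matrix (Fin N) ι K)
    (i : Fin N) : ℝ :=
  bhattacharyya (synthChannel W G i)

/-- `A` is an information set for `W` and `G`: every synthetic channel inside `A` has
Bhattacharyya parameter at most that of every synthetic channel outside `A`. -/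
def IsInformationSet {K Y ι : Type*} [Field K] [Fintype K] [DecidableEq K] [Fintype Y]
    [Fintype ι] [DecidableEq ι] {N : ℕ} (W : K → Y → ℝ) (G : Matrix (Fin N) ι K)
    (A : Set (Fin N)) : Prop :=
  ∀ i ∈ A, ∀ j ∉ A, synthBhattacharyya W G i ≤ synthBhattacharyya W G j

/-- The matrix `T(S)` of a set `S = {a_0, …, a_{l-1}}`: its rows are the evaluations of
`x^(l-1), …, x, 1`, in this order. -/
def setMatrix {K : Type*} [Field K] {l : ℕ} (a : Fin l → K) : Matrix (Fin l) (Fin l) K :=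
  Matrix.of fun r c => a c ^ (r.rev : ℕ)

/-- The matrix `G_m` of the kernels `T(S_1), …, T(S_m)`, where `e k` enumerates `S_k`. -/
def setPolarMatrix {K : Type*} [Field K] {m : ℕ} {S : Fin m → Finset K}
    (e : ∀ k, Fin (S k).card ≃ S k) :
    Matrix (Fin (∏ k, (S k).card)) (∀ k, Fin (S k).card) K :=
  polarMatrix fun k => setMatrix fun c => (e k c : K)

/-- The exponent vector of the monomial that labels row `i` of `G_m`: the row with digits
`(k_1, …, k_m)` is labelled by `x_1^(n_1-1-k_1) ⋯ x_m^(n_m-1-k_m)`. -/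
def rowMonomial {m : ℕ} (n : Fin m → ℕ) (i : Fin (∏ k, n k)) : Fin m →₀ ℕ :=
  Finsupp.equivFunOnFinite.symm fun k => ((finPiFinEquiv.symm i k).rev : ℕ)

/-- Row `i` of `G_m` is the vector of values of its monomial at the points of
`S_1 × ⋯ × S_m`. -/
theorem setPolarMatrix_row {K : Type*} [Field K] {m : ℕ} {S : Fin m → Finset K}
    (e : ∀ k, Fin (S k).card ≃ S k) (i : Fin (∏ k, (S k).card)) (c : ∀ k, Fin (S k).card) :
    setPolarMatrix e i c =
      MvPolynomial.eval (fun k => (e k (c k) : K))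
        (MvPolynomial.monomial (rowMonomial (fun k => (S k).card) i) 1) := by
  simp [setPolarMatrix, polarMatrix, setMatrix, rowMonomial, MvPolynomial.eval_monomial,
    Finsupp.prod_fintype]

/-- A set of row indices of `G_m`, viewed as a set of monomials (exponent vectors). -/
def monomialsOf {m : ℕ} (n : Fin m → ℕ) (A : Set (Fin (∏ k, n k))) : Set (Fin m →₀ ℕ) :=
  rowMonomial n '' A

/-- The order `⊴` on monomials in `x_1, …, x_m` (given by exponent vectors) attached to
`S_1, …, S_m`: the smallest transitive relation that satisfies the three rules. -/
inductive PolarLE {K : Type*} {m : ℕ} (S : Fin m → Finset K) :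
    (Fin m →₀ ℕ) → (Fin m →₀ ℕ) → Prop
  /-- If `M'` divides `M`, then `M' ⊴ M`. -/
  | of_dvd {M' M : Fin m →₀ ℕ} (h : M' ≤ M) : PolarLE S M' M
  /-- `x_{j_1}^{a_1} ⋯ x_{j_s}^{a_s} ⊴ x_{h_1}^{a_1} ⋯ x_{h_s}^{a_s}` for increasing indices
  `j_1 < ⋯ < j_s` and `h_1 < ⋯ < h_s` at which the sets `S_i` all coincide, if `j_t ≤ h_t` for
  all `t`. -/
  | shift {s : ℕ} (T : Finset K) (j h : Fin s → Fin m) (a : Fin s → ℕ)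
      (hj : StrictMono j) (hh : StrictMono h) (hSj : ∀ t, S (j t) = T) (hSh : ∀ t, S (h t) = T)
      (hjh : ∀ t, j t ≤ h t) :
      PolarLE S (∑ t, Finsupp.single (j t) (a t)) (∑ t, Finsupp.single (h t) (a t))
  /-- If `M ⊴ M'` involve only the first `k` variables and `N ⊴ N'` only the remaining ones,
  then `M N ⊴ M' N'`. -/
  | mul (k : ℕ) (hk : 1 ≤ k) (hkm : k < m) {M M' N N' : Fin m →₀ ℕ}
      (hM : ∀ i ∈ M.support, (i : ℕ) < k) (hM' : ∀ i ∈ M'.support, (i : ℕ) < k)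
      (hN : ∀ i ∈ N.support, k ≤ (i : ℕ)) (hN' : ∀ i ∈ N'.support, k ≤ (i : ℕ))
      (h₁ : PolarLE S M M') (h₂ : PolarLE S N N') : PolarLE S (M + N) (M' + N')
  | trans {M₁ M₂ M₃ : Fin m →₀ ℕ} (h₁ : PolarLE S M₁ M₂) (h₂ : PolarLE S M₂ M₃) :
      PolarLE S M₁ M₃

end

end PolarCode

/-! A receiver of the synthetic channel `i` knows the inputs before `i` and can cancel their
contribution. Symmetry over the field lets it turn the output for `x` into an output for `a * x +
b`, coordinate by coordinate. Suppose an operator `F ↦ a · (F ∘ π)` on functions on the evaluation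
points sends row `i` to row `i'` plus later rows, and rows after `i` into the span of the rows after
`i'`. Then the receiver can simulate channel `i'`, and Cauchy–Schwarz gives `Z(i) ≤ Z(i')`
(`synthBhattacharyya_le_of_affine`).

Two operators suffice: multiplication by a coordinate `x_k`, which takes `M` to `x_k M`, and the
interchange of two coordinates with equal sets, which moves an exponent from `x_j` up to `x_h` when
no other variable in between occurs. Both are compatible with the order of the rows. Every relation
of `⊴` is a chain of such steps (`PolarLE.reflTransGen`), so `Z` is monotone along `⊴`. Hence `M' ⊴
M` with different parameters forces `Z(M') < Z(M)`, and `M'` cannot lie outside an information set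
containing `M`. -/

namespace PolarCode

/-! ### Degradation and affine simulation of a symmetric channel -/

/-- Post-processing the output of a channel by a stochastic kernel does not decrease the
Bhattacharyya distances. -/
theorem bhattacharyyaDist_le_of_degraded {X O O' : Type*} [Fintype O] [Fintype O']
    {V : X → O → ℝ} {V' : X → O' → ℝ} {P : O → O' → ℝ} (hV : ∀ x o, 0 ≤ V x o)
    (hP : IsChannel P) (h : ∀ x o', V' x o' = ∑ o, V x o * P o o') (x x' : X) :
    bhattacharyyaDist V x x' ≤ bhattacharyyaDist V' x x' := by
  have hVP : ∀ x o o', 0 ≤ V x o * P o o' := fun x o o' => mul_nonneg (hV x o) (hP.1 o o')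
  -- Each row of `P` sums to one, so the term of `o` can be spread over all `o'`; what remains is
  -- Cauchy–Schwarz for each `o'`.
  have h1 : bhattacharyyaDist V x x' =
      ∑ o', ∑ o, Real.sqrt (V x o * P o o') * Real.sqrt (V x' o * P o o') := by
    rw [Finset.sum_comm]
    refine Finset.sum_congr rfl fun o _ => ?_
    have : ∀ o', Real.sqrt (V x o * P o o') * Real.sqrt (V x' o * P o o') =
        Real.sqrt (V x o * V x' o) * P o o' := fun o' => by
      rw [← Real.sqrt_mul (hVP x o o'), mul_mul_mul_comm,
        Real.sqrt_mul (mul_nonneg (hV x o) (hV x' o)), Real.sqrt_mul_self (hP.1 o o')]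
    simp_rw [this]
    rw [← Finset.mul_sum, hP.2 o, mul_one]
  rw [h1]
  refine Finset.sum_le_sum fun o' _ => ?_
  rw [h x o', h x' o', Real.sqrt_mul (Finset.sum_nonneg fun o _ => hVP x o o')]
  exact Real.sum_sqrt_mul_sqrt_le _ (fun o => hVP x o o') (fun o => hVP x' o o')

/-- For a channel that is symmetric over the field, the output for the input `a * x + b` can be
simulated from the output for the input `x`. -/
theorem SymmetricOverField.exists_affine_kernel {K Y : Type*} [Field K] [Fintype Y]
    {W : K → Y → ℝ} (hW : IsChannel W) (hsof : SymmetricOverField W) (a b : K) :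
    ∃ Q : Y → Y → ℝ, IsChannel Q ∧ ∀ x y', ∑ y, W x y * Q y y' = W (a * x + b) y' := by
  classical
  by_cases ha : a = 0
  -- For `a = 0` the received output is discarded and a fresh one is drawn from `W b`.
  · refine ⟨fun _ y' => W b y', ⟨fun _ y => hW.1 b y, fun _ => hW.2 b⟩, fun x y' => ?_⟩
    rw [← Finset.sum_mul, hW.2 x, ha, one_mul, zero_mul, zero_add]
  · obtain ⟨ψ, hψ⟩ := hsof.2 a ha
    obtain ⟨σ, hσ⟩ := hsof.1 b
    refine ⟨fun y y' => if (ψ.trans σ) y = y' then 1 else 0, ⟨fun y y' => ?_, fun y => ?_⟩,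
      fun x y' => ?_⟩
    · dsimp only
      split_ifs <;> norm_num
    · exact Fintype.sum_ite_eq _ _
    · rw [Finset.sum_eq_single ((ψ.trans σ).symm y')]
      · rw [hψ, hσ]; simp
      · intro y _ hy
        dsimp only
        rw [if_neg (fun h => hy ((Equiv.eq_symm_apply _).2 h)), mul_zero]
      · simp

/-! ### Simulation of one synthetic channel by another -/

theorem card_filter_apply_eq {K : Type*} [Fintype K] [DecidableEq K] {N : ℕ} (i : Fin N) (x : K) :
    (Finset.univ.filter fun u : Fin N → K => u i = x).card = Fintype.card K ^ (N - 1) := by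
  have : (Finset.univ.filter fun u : Fin N → K => u i = x) =
      Fintype.piFinset fun j => if j = i then {x} else Finset.univ := by
    ext u
    simp only [Finset.mem_filter, Finset.mem_univ, true_and, Fintype.mem_piFinset]
    refine ⟨fun h j => ?_, fun h => by simpa using h i⟩
    split_ifs with hj
    · subst hj; simpa using h
    · simp
  rw [this, Fintype.card_piFinset, ← Finset.mul_prod_erase _ _ (Finset.mem_univ i)]
  rw [Finset.prod_congr rfl (g := fun _ => Fintype.card K)]
  · simp [Finset.card_erase_of_mem]
  · intro j hj
    rw [if_neg (Finset.ne_of_mem_erase hj), Finset.card_univ]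

/-- Summation over the earlier inputs and then over the compatible input vectors. -/
theorem sum_prior_sum_filter {K : Type*} [Fintype K] [DecidableEq K] {N : ℕ} (i : Fin N) (x : K)
    (f : ({j : Fin N // j < i} → K) → (Fin N → K) → ℝ) :
    ∑ p : {j : Fin N // j < i} → K,
      ∑ u : Fin N → K with u i = x ∧ ∀ j : {j : Fin N // j < i}, u j = p j, f p u =
    ∑ u : Fin N → K with u i = x, f (fun j => u j) u := by
  simp_rw [Finset.sum_filter]
  rw [Finset.sum_comm]
  refine Finset.sum_congr rfl fun u _ => ?_
  by_cases hu : u i = x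
  · rw [Finset.sum_eq_single fun j : {j : Fin N // j < i} => u j]
    · simp [hu]
    · intro p _ hp
      rw [if_neg]
      rintro ⟨-, h⟩
      exact hp (funext fun j => (h j).symm)
    · simp
  · simp [hu]

theorem sum_prod_eq_one {Y ι : Type*} [Fintype Y] [Fintype ι] [DecidableEq ι]
    {Q : ι → Y → ℝ} (hQ : ∀ c, ∑ y, Q c y = 1) : ∑ y : ι → Y, ∏ c, Q c (y c) = 1 := by
  rw [← Fintype.prod_sum]
  exact Finset.prod_eq_one fun c _ => hQ c

/-- If the operator `F ↦ (c ↦ a c * F (π c))` maps row `i` into row `i'` plus combinations of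
later rows, and rows after `i` into combinations of rows after `i'`, then the synthetic channel
`i` is at least as good as the synthetic channel `i'`. -/
theorem synthBhattacharyya_le_of_affine {K Y ι : Type*} [Field K] [Fintype K]
    [DecidableEq K] [Fintype Y] [Fintype ι] [DecidableEq ι] {W : K → Y → ℝ}
    (hW : IsChannel W) (hsof : SymmetricOverField W) {N : ℕ} (G : Matrix (Fin N) ι K)
    (i i' : Fin N) (π : Equiv.Perm ι) (a : ι → K)
    (h : ∀ u : Fin N → K, (∀ j < i, u j = 0) → ∃ s : Fin N → K, (∀ j < i', s j = 0) ∧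
      s i' = u i ∧ ∀ c, a c * (u ᵥ* G) (π c) = (s ᵥ* G) c) :
    synthBhattacharyya W G i ≤ synthBhattacharyya W G i' := by
  choose Q hQ hQW using hsof.exists_affine_kernel hW
  set q : ℝ := (Fintype.card K : ℝ) ^ (N - 1) with hq
  have hq0 : 0 < q := pow_pos (by exact_mod_cast Fintype.card_pos) _
  let ext : ({j : Fin N // j < i} → K) → Fin N → K := fun p j => if hj : j < i then p ⟨j, hj⟩ else 0
  let t : ({j : Fin N // j < i} → K) → (Fin N → K) → ι → K :=
    fun p w c => (w ᵥ* G) c - a c * (ext p ᵥ* G) (π c)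
  -- The simulation draws `w` uniformly with `w i' = 0`, reports its entries before `i'`, and
  -- applies to the output at `π c` the kernel of `x ↦ a c * x + t p w c`. The shift `t` cancels the
  -- known inputs and adds the codeword of `w`; the entry at `i'` is left to the true input.
  let P : ((ι → Y) × ({j : Fin N // j < i} → K)) → ((ι → Y) × ({j : Fin N // j < i'} → K)) → ℝ :=
    fun o o' => 1 / q * ∑ w : Fin N → K with w i' = 0 ∧ ∀ j : {j : Fin N // j < i'}, w j = o'.2 j,
      ∏ c, Q (a c) (t o.2 w c) (o.1 (π c)) (o'.1 c)
  have hP : IsChannel P := by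
    refine ⟨fun o o' => ?_, fun o => ?_⟩
    · exact mul_nonneg (by positivity) (Finset.sum_nonneg fun w _ =>
        Finset.prod_nonneg fun c _ => (hQ _ _).1 _ _)
    · rw [Fintype.sum_prod_type]
      simp only [P]
      simp_rw [← Finset.mul_sum]
      simp_rw [sum_prior_sum_filter i' 0 fun _ w => ∏ c, Q (a c) (t o.2 w c) (o.1 (π c)) _]
      rw [Finset.sum_comm]
      simp_rw [sum_prod_eq_one fun c => (hQ (a c) (t o.2 _ c)).2 (o.1 (π c))]
      rw [Finset.sum_const, card_filter_apply_eq, nsmul_eq_mul, mul_one, Nat.cast_pow]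
      exact one_div_mul_cancel hq0.ne'
  have hV : ∀ x o, 0 ≤ synthChannel W G i x o := fun x o =>
    mul_nonneg (by positivity) (Finset.sum_nonneg fun u _ =>
        Finset.prod_nonneg fun c _ => hW.1 _ _)
  have key : ∀ (u w : Fin N → K) (p : {j : Fin N // j < i} → K) (y' : ι → Y),
      ∑ y : ι → Y, (∏ c, W ((u ᵥ* G) c) (y c)) * ∏ c, Q (a c) (t p w c) (y (π c)) (y' c) =
      ∏ c, W (a c * (u ᵥ* G) (π c) + t p w c) (y' c) := by
    intro u w p y'
    simp_rw [← hQW]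
    rw [Fintype.prod_sum, ← (Equiv.arrowCongr π (Equiv.refl Y)).sum_comp]
    refine Finset.sum_congr rfl fun y _ => ?_
    rw [← Equiv.prod_comp π fun c => W ((u ᵥ* G) c) _, ← Finset.prod_mul_distrib]
    simp
  have hdeg : ∀ x o', synthChannel W G i' x o' = ∑ o, synthChannel W G i x o * P o o' := by
    rintro x ⟨y', p'⟩
    rw [Fintype.sum_prod_type_right]
    have h1 : ∀ p : {j : Fin N // j < i} → K,
        ∑ y, synthChannel W G i x (y, p) * P (y, p) (y', p') =
        ∑ u : Fin N → K with u i = x ∧ ∀ j : {j : Fin N // j < i}, u j = p j, 1 / q * (1 / q *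
          ∑ w : Fin N → K with w i' = 0 ∧ ∀ j : {j : Fin N // j < i'}, w j = p' j,
            ∏ c, W (a c * (u ᵥ* G) (π c) + t p w c) (y' c)) := by
      intro p
      simp_rw [← key]
      simp only [synthChannel, P, ← hq]
      simp_rw [mul_mul_mul_comm, Finset.sum_mul_sum, Finset.mul_sum]
      rw [Finset.sum_comm]
      refine Finset.sum_congr rfl fun u _ => ?_
      rw [Finset.sum_comm]
      simp_rw [mul_assoc]
    simp_rw [h1]
    rw [sum_prior_sum_filter]
    have h2 : ∀ u ∈ Finset.univ.filter (fun u : Fin N → K => u i = x),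
        1 / q * (1 / q *
          ∑ w : Fin N → K with w i' = 0 ∧ ∀ j : {j : Fin N // j < i'}, w j = p' j,
            ∏ c, W (a c * (u ᵥ* G) (π c) + t (fun j => u j) w c) (y' c)) =
        1 / q * synthChannel W G i' x (y', p') := by
      intro u hu
      -- Without the known inputs, `u` vanishes before `i` and keeps its entry `x` at `i`. As `w`
      -- varies, `w + s` runs over all vectors with entry `x` at `i'` and earlier entries `p'`, so
      -- the sum does not depend on `u`.
      obtain ⟨s, hs, hsi, hsG⟩ := h (u - ext fun j => u j) fun j hj => by simp [ext, hj]
      have hs' : s i' = x := by simpa [ext, hsi] using hu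
      congr 2
      refine Finset.sum_equiv (Equiv.addRight s) (fun w => ?_) fun w _ => ?_
      · simp only [Finset.mem_filter, Finset.mem_univ, true_and, Equiv.coe_addRight, Pi.add_apply,
          hs', add_eq_right]
        refine and_congr_right fun _ => forall_congr' fun j => ?_
        rw [hs j j.2, add_zero]
      · refine Finset.prod_congr rfl fun c _ => ?_
        congr 1
        simp only [t, Equiv.coe_addRight, Matrix.add_vecMul, Pi.add_apply, ← hsG,
          Matrix.sub_vecMul, Pi.sub_apply]
        ring
    rw [Finset.sum_congr rfl h2, Finset.sum_const, card_filter_apply_eq, nsmul_eq_mul,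
      Nat.cast_pow, ← hq, ← mul_assoc, mul_one_div_cancel hq0.ne', one_mul]
  unfold synthBhattacharyya bhattacharyya
  refine mul_le_mul_of_nonneg_left (Finset.sum_le_sum fun x _ =>
    bhattacharyyaDist_le_of_degraded hV hP hdeg _ _) ?_
  have : (1 : ℝ) ≤ Fintype.card K := by exact_mod_cast Fintype.card_pos
  exact one_div_nonneg.2 (mul_nonneg (by linarith) (by linarith))

/-- A version of `synthBhattacharyya_le_of_affine` with a condition on single rows. -/
theorem synthBhattacharyya_le_of_rows {K Y ι : Type*} [Field K] [Fintype K]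
    [DecidableEq K] [Fintype Y] [Fintype ι] [DecidableEq ι] {W : K → Y → ℝ}
    (hW : IsChannel W) (hsof : SymmetricOverField W) {N : ℕ} (G : Matrix (Fin N) ι K)
    (i i' : Fin N) (π : Equiv.Perm ι) (a : ι → K)
    (h : ∀ r, i ≤ r → ∃ s : Fin N → K, (∀ j < i', s j = 0) ∧
      s i' = (if r = i then 1 else 0) ∧ ∀ c, a c * G r (π c) = (s ᵥ* G) c) :
    synthBhattacharyya W G i ≤ synthBhattacharyya W G i' := by
  refine synthBhattacharyya_le_of_affine hW hsof G i i' π a fun u hu => ?_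
  choose! s hs hsi hsG using h
  have hu' : ∀ r, r < i ∨ i ≤ r := fun r => lt_or_ge r i
  refine ⟨∑ r, u r • s r, fun j hj => ?_, ?_, fun c => ?_⟩
  · rw [Finset.sum_apply]
    refine Finset.sum_eq_zero fun r _ => ?_
    rcases hu' r with hr | hr
    · simp [hu r hr]
    · simp [hs r hr j hj]
  · rw [Finset.sum_apply, Finset.sum_eq_single i]
    · simp [hsi i le_rfl]
    · intro r _ hri
      rcases hu' r with hr | hr
      · simp [hu r hr]
      · simp [hsi r hr, hri]
    · simp
  · rw [Matrix.sum_vecMul, Finset.sum_apply, Matrix.vecMul_eq_sum, Finset.sum_apply, Finset.mul_sum]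
    refine Finset.sum_congr rfl fun r _ => ?_
    rw [Matrix.smul_vecMul, Pi.smul_apply, Pi.smul_apply]
    rcases hu' r with hr | hr
    · simp [hu r hr]
    · rw [← hsG r hr c, smul_eq_mul, smul_eq_mul]
      ring

/-! ### The order of the rows -/

/-- The numbering of the digit tuples is colexicographic. -/
theorem finPiFinEquiv_lt {m : ℕ} {n : Fin m → ℕ} {f g : ∀ k, Fin (n k)} (k : Fin m)
    (hk : f k < g k) (h : ∀ l, k < l → f l = g l) : finPiFinEquiv f < finPiFinEquiv g := by
  induction m with
  | zero => exact k.elim0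
  | succ m ih =>
    have hsucc : ∀ f : ∀ k, Fin (n k), (finPiFinEquiv f : ℕ) =
        (finPiFinEquiv (fun i : Fin m => f i.castSucc) : ℕ) +
          f (Fin.last m) * ∏ j : Fin m, n j.castSucc := by
      intro f
      rw [finPiFinEquiv_apply, Fin.sum_univ_castSucc]
      rfl
    rw [Fin.lt_def, hsucc, hsucc]
    induction k using Fin.lastCases with
    | last =>
      have h1 := (finPiFinEquiv (fun i : Fin m => f i.castSucc)).isLt
      have h2 := Nat.mul_le_mul_right (∏ j : Fin m, n j.castSucc) (Nat.succ_le_of_lt hk)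
      rw [Nat.succ_mul] at h2
      omega
    | cast k =>
      rw [h _ (Fin.castSucc_lt_last k)]
      exact Nat.add_lt_add_right (ih k hk fun l hl => h _ (Fin.castSucc_lt_castSucc_iff.2 hl)) _

theorem finPiFinEquiv_lt_iff {m : ℕ} {n : Fin m → ℕ} {f g : ∀ k, Fin (n k)} :
    finPiFinEquiv f < finPiFinEquiv g ↔ ∃ k, f k < g k ∧ ∀ l, k < l → f l = g l := by
  refine ⟨fun h => ?_, fun ⟨k, hk, hl⟩ => finPiFinEquiv_lt k hk hl⟩
  have hne : (Finset.univ.filter fun k => f k ≠ g k).Nonempty := by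
    by_contra hcon
    rw [Finset.not_nonempty_iff_eq_empty, Finset.filter_eq_empty_iff] at hcon
    exact h.ne (congrArg _ (funext fun k => not_not.1 (hcon (Finset.mem_univ k))))
  obtain ⟨k, hk, hmax⟩ := Finset.exists_max_image _ id hne
  have hl : ∀ l, k < l → f l = g l := fun l hl => by
    by_contra hcon
    exact absurd (hmax l (by simpa using hcon)) (not_le.2 hl)
  rcases lt_or_gt_of_ne (Finset.mem_filter.1 hk).2 with hlt | hlt
  · exact ⟨k, hlt, hl⟩
  · exact absurd (finPiFinEquiv_lt k hlt fun l hl' => (hl l hl').symm) h.asymm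

section RowMonomial

variable {m : ℕ} {n : Fin m → ℕ}

theorem rowMonomial_apply (i : Fin (∏ k, n k)) (k : Fin m) :
    rowMonomial n i k = ((finPiFinEquiv.symm i k).rev : ℕ) := rfl

theorem rowMonomial_lt (i : Fin (∏ k, n k)) (k : Fin m) : rowMonomial n i k < n k :=
  (finPiFinEquiv.symm i k).rev.isLt

theorem exists_rowMonomial_eq {M : Fin m →₀ ℕ} (hM : ∀ k, M k < n k) :
    ∃ i, rowMonomial n i = M := by
  refine ⟨finPiFinEquiv fun k => (⟨M k, hM k⟩ : Fin (n k)).rev, ?_⟩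
  ext k
  rw [rowMonomial_apply, Equiv.symm_apply_apply, Fin.rev_rev]

theorem rowMonomial_injective : Function.Injective (rowMonomial n) := by
  intro i j h
  refine finPiFinEquiv.symm.injective (funext fun k => Fin.rev_injective (Fin.ext ?_))
  rw [← rowMonomial_apply, ← rowMonomial_apply, h]

/-- Exponents are reversed digits, so the rows run through the monomials in decreasing
colexicographic order. -/
theorem rowMonomial_lt_iff {i j : Fin (∏ k, n k)} : i < j ↔
    ∃ k, rowMonomial n j k < rowMonomial n i k ∧
      ∀ l, k < l → rowMonomial n j l = rowMonomial n i l := by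
  rw [← finPiFinEquiv.apply_symm_apply i, ← finPiFinEquiv.apply_symm_apply j,
    finPiFinEquiv_lt_iff]
  simp only [rowMonomial_apply, finPiFinEquiv.symm_apply_apply, ← Fin.lt_def, Fin.rev_lt_rev,
    ← Fin.ext_iff, Fin.rev_inj, eq_comm]

/-- Multiplication by `x_k` raises both exponents at `k`, so the deciding variable does not change.
The equivalence makes row `i` the only one contributing to the coefficient at `i'`. -/
theorem row_le_of_update {k : Fin m} {i i' r r' : Fin (∏ k, n k)}
    (h : rowMonomial n i' = rowMonomial n i + Finsupp.single k 1) (hr : i ≤ r)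
    (hr' : rowMonomial n r' = (rowMonomial n r).update k (rowMonomial n r k + 1)) :
    i' ≤ r' ∧ (r' = i' ↔ r = i) := by
  have hi'k : rowMonomial n i' k = rowMonomial n i k + 1 := by simp [h]
  have hi'l : ∀ l, l ≠ k → rowMonomial n i' l = rowMonomial n i l := by
    intro l hl
    simp [h, hl.symm]
  have hr'k : rowMonomial n r' k = rowMonomial n r k + 1 := by simp [hr']
  have hr'l : ∀ l, l ≠ k → rowMonomial n r' l = rowMonomial n r l := by
    intro l hl
    simp [hr', Finsupp.update_apply, hl]
  rcases hr.eq_or_lt with rfl | hlt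
  · have : r' = i' := by
      refine rowMonomial_injective (Finsupp.ext fun l => ?_)
      by_cases hl : l = k
      · rw [hl, hr'k, hi'k]
      · rw [hr'l l hl, hi'l l hl]
    simp [this]
  · have hlt' : i' < r' := by
      obtain ⟨l, hl, hl'⟩ := rowMonomial_lt_iff.1 hlt
      refine rowMonomial_lt_iff.2 ⟨l, ?_, fun l' hll' => ?_⟩
      · by_cases hlk : l = k
        · subst hlk; omega
        · rwa [hr'l l hlk, hi'l l hlk]
      · have := hl' l' hll'
        by_cases hlk : l' = k
        · subst hlk; omega
        · rwa [hr'l l' hlk, hi'l l' hlk]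
    exact ⟨hlt'.le, by simp [hlt'.ne', hlt.ne']⟩

/-- The case where multiplication by `x_k` overflows. Row `r` has a larger exponent at `k` than row
`i` but is not earlier, so the comparison is decided beyond `k`, whatever exponent `d` is put at
`k`. -/
theorem row_lt_of_update {k : Fin m} {i i' r r' : Fin (∏ k, n k)}
    (h : rowMonomial n i' = rowMonomial n i + Finsupp.single k 1) (hr : i ≤ r)
    (hrk : rowMonomial n r k + 1 = n k) {d : ℕ}
    (hr' : rowMonomial n r' = (rowMonomial n r).update k d) : i' < r' ∧ r ≠ i := by
  have hi'k : rowMonomial n i' k = rowMonomial n i k + 1 := by simp [h]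
  have hi'l : ∀ l, l ≠ k → rowMonomial n i' l = rowMonomial n i l := by
    intro l hl
    simp [h, hl.symm]
  have hik : rowMonomial n i' k < n k := rowMonomial_lt i' k
  have hne : r ≠ i := by rintro rfl; omega
  obtain ⟨l, hl, hl'⟩ := rowMonomial_lt_iff.1 (hr.lt_of_ne' hne)
  have hkl : k < l := by
    rcases lt_trichotomy k l with h1 | h1 | h1
    · exact h1
    · subst h1; omega
    · have := hl' k h1; omega
  have hupd : ∀ l, l ≠ k → rowMonomial n r' l = rowMonomial n r l := by
    intro l hl
    simp [hr', Finsupp.update_apply, hl]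
  refine ⟨rowMonomial_lt_iff.2 ⟨l, ?_, fun l' hll' => ?_⟩, hne⟩
  · rwa [hupd l hkl.ne', hi'l l hkl.ne']
  · rw [hupd l' (hkl.trans hll').ne', hi'l l' (hkl.trans hll').ne', hl' l' hll']

theorem exists_rowMonomial_eq_update (r : Fin (∏ k, n k)) {k : Fin m} {d : ℕ} (hd : d < n k) :
    ∃ r', rowMonomial n r' = (rowMonomial n r).update k d := by
  refine exists_rowMonomial_eq fun l => ?_
  by_cases hl : l = k
  · subst hl; simpa using hd
  · simpa [Finsupp.update_apply, hl] using rowMonomial_lt r l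

theorem exists_rowMonomial_eq_swap (r : Fin (∏ k, n k)) {j h : Fin m} (hn : n j = n h) :
    ∃ r', ∀ k, rowMonomial n r' k = rowMonomial n r (Equiv.swap j h k) := by
  obtain ⟨r', hr'⟩ := exists_rowMonomial_eq (n := n)
    (M := Finsupp.equivFunOnFinite.symm fun k => rowMonomial n r (Equiv.swap j h k)) fun k => by
      rw [Finsupp.equivFunOnFinite_symm_apply_apply]
      refine (rowMonomial_lt r _).trans_eq ?_
      by_cases h1 : k = j
      · rw [h1, Equiv.swap_apply_left, hn]
      · by_cases h2 : k = h
        · rw [h2, Equiv.swap_apply_right, hn]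
        · rw [Equiv.swap_apply_of_ne_of_ne h1 h2]
  exact ⟨r', fun k => by rw [hr', Finsupp.equivFunOnFinite_symm_apply_apply]⟩

/-- Row `i` has exponent zero throughout `(j, h]`, so no later row can have a smaller one there. The
deciding variable is at most `j` or beyond `h`, and the interchange then preserves the comparison.
-/
theorem row_le_of_swap {j h : Fin m} (hjh : j < h) {B : Fin m →₀ ℕ} {a : ℕ}
    (hB : ∀ k, j ≤ k → k ≤ h → B k = 0) {i i' r r' : Fin (∏ k, n k)}
    (hi : rowMonomial n i = B + Finsupp.single j a)
    (hi' : rowMonomial n i' = B + Finsupp.single h a) (hr : i ≤ r)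
    (hr' : ∀ k, rowMonomial n r' k = rowMonomial n r (Equiv.swap j h k)) :
    i' ≤ r' ∧ (r' = i' ↔ r = i) := by
  have hsw : ∀ k, k ≠ j → k ≠ h → Equiv.swap j h k = k :=
    fun k h1 h2 => Equiv.swap_apply_of_ne_of_ne h1 h2
  have hii' : ∀ k, rowMonomial n i' k = rowMonomial n i (Equiv.swap j h k) := by
    intro k
    by_cases h1 : k = j
    · subst h1
      rw [Equiv.swap_apply_left, hi, hi']
      simp [hB k le_rfl hjh.le, hB h hjh.le le_rfl, hjh.ne, hjh.ne']
    · by_cases h2 : k = h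
      · subst h2
        rw [Equiv.swap_apply_right, hi, hi']
        simp [hB k hjh.le le_rfl, hB j le_rfl hjh.le]
      · rw [hsw k h1 h2, hi, hi']
        simp [Ne.symm h1, Ne.symm h2]
  rcases hr.eq_or_lt with rfl | hlt
  · have : r' = i' := rowMonomial_injective (Finsupp.ext fun l => by rw [hr', hii'])
    simp [this]
  · have hlt' : i' < r' := by
      obtain ⟨l, hl, hl'⟩ := rowMonomial_lt_iff.1 hlt
      have hl_out : l ≤ j ∨ h < l := by
        by_contra! hcon
        have : rowMonomial n i l = 0 := by
          rw [hi]
          simp [hB l hcon.1.le hcon.2, hcon.1.ne]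
        omega
      rcases hl_out with hlj | hlh
      · rcases hlj.eq_or_lt with rfl | hlj
        · refine rowMonomial_lt_iff.2 ⟨h, ?_, fun l' hll' => ?_⟩
          · rwa [hr', hii', Equiv.swap_apply_right]
          · rw [hr', hii', hsw l' (hjh.trans hll').ne' hll'.ne']
            exact hl' l' (hjh.trans hll')
        · refine rowMonomial_lt_iff.2 ⟨l, ?_, fun l' hll' => ?_⟩
          · rwa [hr', hii', hsw l hlj.ne (hlj.trans hjh).ne]
          · rw [hr', hii']
            refine hl' _ ?_
            by_cases h1 : l' = j
            · rw [h1, Equiv.swap_apply_left]; exact hlj.trans hjh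
            · by_cases h2 : l' = h
              · rw [h2, Equiv.swap_apply_right]; exact hlj
              · rwa [hsw l' h1 h2]
      · refine rowMonomial_lt_iff.2 ⟨l, ?_, fun l' hll' => ?_⟩
        · rwa [hr', hii', hsw l (hjh.trans hlh).ne' hlh.ne']
        · rw [hr', hii', hsw l' (hjh.trans (hlh.trans hll')).ne' (hlh.trans hll').ne']
          exact hl' l' hll'
    exact ⟨hlt'.le, by simp [hlt'.ne', hlt.ne']⟩

theorem setPolarMatrix_apply {K : Type*} [Field K] {S : Fin m → Finset K}
    (e : ∀ k, Fin (S k).card ≃ S k) (i : Fin (∏ k, (S k).card)) (c : ∀ k, Fin (S k).card) :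
    setPolarMatrix e i c = ∏ k, (e k (c k) : K) ^ rowMonomial (fun k => (S k).card) i k := rfl

end RowMonomial

/-! ### The two operators and their effect on the rows -/

/-- On a set with `n` elements, `x ^ n` is a polynomial of degree less than `n`. -/
theorem exists_pow_card_eq_sum {K : Type*} [Field K] (S : Finset K) :
    ∃ a : ℕ → K, ∀ x ∈ S, x ^ S.card = ∑ d ∈ Finset.range S.card, a d * x ^ d := by
  classical
  have hinj : Set.InjOn (id : K → K) S := Function.injective_id.injOn
  let p := Lagrange.interpolate S id fun x => x ^ S.card
  refine ⟨p.coeff, fun x hx => ?_⟩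
  have h := Lagrange.eval_interpolate_at_node (fun x => x ^ S.card) hinj hx
  rw [← h, id]
  by_cases hp : p = 0
  · change p.eval x = _
    simp [hp]
  · refine Polynomial.eval_eq_sum_range' ?_ x
    exact (Polynomial.natDegree_lt_iff_degree_lt hp).2 (Lagrange.degree_interpolate_lt _ hinj)

/-- Interchanging two coordinates with equal sets permutes the columns of `G_m`. -/
theorem exists_perm_swap {K : Type*} {m : ℕ} {S : Fin m → Finset K}
    (e : ∀ k, Fin (S k).card ≃ S k) (j h : Fin m) (hS : S j = S h) :
    ∃ π : Equiv.Perm (∀ k, Fin (S k).card), ∀ c k,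
      (e k (π c k) : K) = e (Equiv.swap j h k) (c (Equiv.swap j h k)) := by
  have hmem : ∀ k, S (Equiv.swap j h k) = S k := by
    intro k
    by_cases h1 : k = j
    · rw [h1, Equiv.swap_apply_left, hS]
    · by_cases h2 : k = h
      · rw [h2, Equiv.swap_apply_right, hS]
      · rw [Equiv.swap_apply_of_ne_of_ne h1 h2]
  have hmem' : ∀ (c : ∀ k, Fin (S k).card) k,
      (e (Equiv.swap j h k) (c (Equiv.swap j h k)) : K) ∈ S k := fun c k => by
    rw [← hmem k]
    exact (e _ _).2
  -- Points are transported, not indices: `e j` and `e h` may enumerate the common set differently.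
  let f : (∀ k, Fin (S k).card) → ∀ k, Fin (S k).card := fun c k => (e k).symm ⟨_, hmem' c k⟩
  have hf : ∀ c k, (e k (f c k) : K) = e (Equiv.swap j h k) (c (Equiv.swap j h k)) := by
    intro c k
    simp [f]
  have hinv : Function.Involutive f := by
    intro c
    refine funext fun k => (e k).injective (Subtype.ext ?_)
    rw [hf, hf, Equiv.swap_apply_self]
  exact ⟨hinv.toPerm, hf⟩

section Steps

variable {K Y : Type*} [Field K] [Fintype K] [DecidableEq K] [Fintype Y] {m : ℕ}
  {S : Fin m → Finset K} (e : ∀ k, Fin (S k).card ≃ S k) {W : K → Y → ℝ}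

/-- Dividing a monomial by a variable improves its synthetic channel. -/
theorem synthBhattacharyya_le_of_add_single (hW : IsChannel W) (hsof : SymmetricOverField W)
    (k : Fin m) {i i' : Fin (∏ k, (S k).card)}
    (h : rowMonomial (fun k => (S k).card) i' =
      rowMonomial (fun k => (S k).card) i + Finsupp.single k 1) :
    synthBhattacharyya W (setPolarMatrix e) i ≤ synthBhattacharyya W (setPolarMatrix e) i' := by
  obtain ⟨α, hα⟩ := exists_pow_card_eq_sum (S k)
  refine synthBhattacharyya_le_of_rows hW hsof _ i i' (Equiv.refl _) (fun c => (e k (c k) : K))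
    fun r hr => ?_
  have hx : ∀ (M : Fin m →₀ ℕ) (d : ℕ) (x : Fin m → K), ∏ l, x l ^ M.update k d l =
      x k ^ d * ∏ l ∈ Finset.univ.erase k, x l ^ M l := by
    intro M d x
    rw [← Finset.mul_prod_erase _ _ (Finset.mem_univ k)]
    congr 1
    · simp
    · exact Finset.prod_congr rfl fun l hl => by
        simp [Finsupp.update_apply, Finset.ne_of_mem_erase hl]
  have hx' : ∀ (M : Fin m →₀ ℕ) (x : Fin m → K), x k * ∏ l, x l ^ M l =
      x k ^ (M k + 1) * ∏ l ∈ Finset.univ.erase k, x l ^ M l := by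
    intro M x
    rw [← Finset.mul_prod_erase _ _ (Finset.mem_univ k), pow_succ']
    ring
  -- `x_k` times row `r` is again a row unless the exponent is already `n_k - 1`; in that case `x_k
  -- ^ n_k` is rewritten on `S k` in lower powers, which gives rows after `i'` only.
  rcases (Nat.succ_le_of_lt (rowMonomial_lt r k)).lt_or_eq with hrk | hrk
  · obtain ⟨r', hr'⟩ := exists_rowMonomial_eq_update r hrk
    obtain ⟨hle, hiff⟩ := row_le_of_update h hr hr'
    refine ⟨Pi.single r' 1, fun j hj => Pi.single_eq_of_ne (hj.trans_le hle).ne _, ?_, fun c => ?_⟩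
    · simp only [Pi.single_apply, eq_comm (a := i'), hiff]
    · rw [Matrix.single_one_vecMul, Matrix.row_apply, setPolarMatrix_apply, setPolarMatrix_apply,
        hr', hx]
      exact hx' _ fun l => (e l (c l) : K)
  · have : Nonempty (Fin (∏ k, (S k).card)) := ⟨i⟩
    choose! r' hr' using fun d (hd : d < (S k).card) =>
      exists_rowMonomial_eq_update (n := fun k => (S k).card) r (k := k) hd
    have hlt : ∀ d ∈ Finset.range (S k).card, i' < r' d := fun d hd =>
      (row_lt_of_update h hr hrk (hr' d (Finset.mem_range.1 hd))).1
    refine ⟨∑ d ∈ Finset.range (S k).card, α d • Pi.single (r' d) 1, fun j hj => ?_, ?_,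
      fun c => ?_⟩
    · rw [Finset.sum_apply]
      refine Finset.sum_eq_zero fun d hd => ?_
      rw [Pi.smul_apply, Pi.single_eq_of_ne (hj.trans (hlt d hd)).ne, smul_zero]
    -- Any admissible exponent shows `r ≠ i`; `0` is one because `n_k` is positive.
    · rw [if_neg (row_lt_of_update h hr hrk (hr' 0 (by omega))).2, Finset.sum_apply]
      refine Finset.sum_eq_zero fun d hd => ?_
      rw [Pi.smul_apply, Pi.single_eq_of_ne (hlt d hd).ne, smul_zero]
    · rw [Matrix.sum_vecMul, Finset.sum_apply, setPolarMatrix_apply]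
      refine (hx' _ fun l => (e l (c l) : K)).trans ?_
      rw [← Nat.succ_eq_add_one, hrk, hα _ (e k (c k)).2, Finset.sum_mul]
      refine Finset.sum_congr rfl fun d hd => ?_
      rw [Matrix.smul_vecMul, Pi.smul_apply, Matrix.single_one_vecMul, Matrix.row_apply,
        setPolarMatrix_apply, hr' d (Finset.mem_range.1 hd), hx, smul_eq_mul, mul_assoc]

/-- Moving the exponent of a variable down to a variable with the same set improves the synthetic
channel, if no other variable in between occurs. -/
theorem synthBhattacharyya_le_of_move (hW : IsChannel W) (hsof : SymmetricOverField W)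
    {j h : Fin m} (hjh : j < h) (hS : S j = S h) {B : Fin m →₀ ℕ} (a : ℕ)
    (hB : ∀ k, j ≤ k → k ≤ h → B k = 0) {i i' : Fin (∏ k, (S k).card)}
    (hi : rowMonomial (fun k => (S k).card) i = B + Finsupp.single j a)
    (hi' : rowMonomial (fun k => (S k).card) i' = B + Finsupp.single h a) :
    synthBhattacharyya W (setPolarMatrix e) i ≤ synthBhattacharyya W (setPolarMatrix e) i' := by
  obtain ⟨π, hπ⟩ := exists_perm_swap e j h hS
  refine synthBhattacharyya_le_of_rows hW hsof _ i i' π 1 fun r hr => ?_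
  obtain ⟨r', hr'⟩ := exists_rowMonomial_eq_swap r (congrArg Finset.card hS)
  obtain ⟨hle, hiff⟩ := row_le_of_swap hjh hB hi hi' hr hr'
  refine ⟨Pi.single r' 1, fun j hj => Pi.single_eq_of_ne (hj.trans_le hle).ne _, ?_, fun c => ?_⟩
  · simp only [Pi.single_apply, eq_comm (a := i'), hiff]
  · rw [Matrix.single_one_vecMul, Matrix.row_apply, setPolarMatrix_apply, setPolarMatrix_apply,
      Pi.one_apply, one_mul, ← Equiv.prod_comp (Equiv.swap j h)]
    refine Finset.prod_congr rfl fun k _ => ?_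
    rw [hπ, Equiv.swap_apply_self, hr']

end Steps

/-! ### Decomposition of the order into elementary steps -/

/-- The elementary steps that generate `⊴`: multiplication by a variable, and moving the exponent
of a variable to a later variable with the same set, past variables that do not occur. -/
inductive ElemLE {K : Type*} {m : ℕ} (S : Fin m → Finset K) :
    (Fin m →₀ ℕ) → (Fin m →₀ ℕ) → Prop
  | incr (M : Fin m →₀ ℕ) (k : Fin m) : ElemLE S M (M + Finsupp.single k 1)
  | move (B : Fin m →₀ ℕ) (j h : Fin m) (a : ℕ) (hjh : j < h) (ha : a ≠ 0) (hS : S j = S h)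
      (hB : ∀ k, j ≤ k → k ≤ h → B k = 0) :
      ElemLE S (B + Finsupp.single j a) (B + Finsupp.single h a)

section Order

variable {K : Type*} {m : ℕ} {S : Fin m → Finset K} {M M' N N' : Fin m →₀ ℕ}

open Relation

theorem reflTransGen_elemLE_add (M N : Fin m →₀ ℕ) :
    ReflTransGen (ElemLE S) M (M + N) := by
  induction N using Finsupp.induction_linear generalizing M with
  | zero => rw [add_zero]
  | add f g hf hg => rw [← add_assoc]; exact (hf M).trans (hg (M + f))
  | single k c =>
    induction c with
    | zero => rw [Finsupp.single_zero, add_zero]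
    | succ c ih =>
      rw [Finsupp.single_add, ← add_assoc]
      exact ih.tail (.incr _ k)

/-- Moves go upward and `a ≠ 0` keeps `h` in the support of the target, so a bound on the variables
passes from target to source. -/
theorem ElemLE.support_lt (h : ElemLE S M M') {k : ℕ} (hM' : ∀ i ∈ M'.support, (i : ℕ) < k) :
    ∀ i ∈ M.support, (i : ℕ) < k := by
  cases h with
  | incr M l =>
    exact fun i hi => hM' i (Finsupp.support_mono le_self_add hi)
  | move B j h a hjh ha hS hB =>
    intro i hi
    rcases Finset.mem_union.1 (Finsupp.support_add hi) with hi | hi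
    · exact hM' i (Finsupp.support_mono le_self_add hi)
    · rw [Finset.mem_singleton.1 (Finsupp.support_single_subset hi)]
      refine lt_trans (Fin.lt_def.1 hjh) (hM' h ?_)
      simp [ha]

/-- A move that ends below `k` never passes a variable of `N`. The bound on `M'` passes back to
every intermediate monomial. -/
theorem reflTransGen_elemLE_add_right (h : ReflTransGen (ElemLE S) M M') {k : ℕ}
    (hM' : ∀ i ∈ M'.support, (i : ℕ) < k) (hN : ∀ i ∈ N.support, k ≤ (i : ℕ)) :
    ReflTransGen (ElemLE S) (M + N) (M' + N) := by
  induction h using ReflTransGen.head_induction_on with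
  | refl => exact .refl
  | @head M M₁ h h' ih =>
    have hM₁ : ∀ i ∈ M₁.support, (i : ℕ) < k := by
      clear h ih
      induction h' using ReflTransGen.head_induction_on with
      | refl => exact hM'
      | head h _ ih => exact h.support_lt ih
    refine ReflTransGen.head ?_ ih
    cases h with
    | incr M l =>
      rw [add_right_comm]
      exact .incr _ l
    | move B j h a hjh ha hS hB =>
      rw [add_right_comm B (.single j a), add_right_comm B (.single h a)]
      refine .move _ j h a hjh ha hS fun l hjl hlh => ?_
      rw [Finsupp.add_apply, hB l hjl hlh, zero_add]
      by_contra hl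
      have h1 := hM₁ h (by simp [ha])
      have h2 := hN l (Finsupp.mem_support_iff.2 hl)
      have h3 := Fin.le_def.1 hlh
      omega

/-- A chain between monomials in the variables from `k` on may still visit earlier variables and
collide with `M`. Discarding those variables leaves a move intact if it starts at or after `k`, and
otherwise turns it into a multiplication or nothing. -/
theorem ElemLE.add_left_filter (h : ElemLE S N N') {k : ℕ}
    (hM : ∀ i ∈ M.support, (i : ℕ) < k) :
    ReflTransGen (ElemLE S) (M + N.filter fun i : Fin m => k ≤ (i : ℕ))
      (M + N'.filter fun i : Fin m => k ≤ (i : ℕ)) := by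
  cases h with
  | incr N l =>
    rw [Finsupp.filter_add, ← add_assoc]
    exact reflTransGen_elemLE_add _ _
  | move B j h a hjh ha hS hB =>
    rw [Finsupp.filter_add, Finsupp.filter_add, ← add_assoc, ← add_assoc]
    by_cases hj : k ≤ (j : ℕ)
    · have hh : k ≤ (h : ℕ) := hj.trans (Fin.le_def.1 hjh.le)
      rw [Finsupp.filter_single_of_pos (fun i : Fin m => k ≤ (i : ℕ)) hj,
        Finsupp.filter_single_of_pos (fun i : Fin m => k ≤ (i : ℕ)) hh]
      refine .single (.move _ j h a hjh ha hS fun l hjl hlh => ?_)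
      have hl : k ≤ (l : ℕ) := hj.trans (Fin.le_def.1 hjl)
      rw [Finsupp.add_apply, Finsupp.filter_apply_pos (fun i : Fin m => k ≤ (i : ℕ)) _ hl,
        hB l hjl hlh, add_zero]
      by_contra hl'
      exact absurd (hM l (Finsupp.mem_support_iff.2 hl')) (not_lt.2 hl)
    · rw [Finsupp.filter_single_of_neg (fun i : Fin m => k ≤ (i : ℕ)) hj, add_zero]
      exact reflTransGen_elemLE_add _ _

theorem reflTransGen_elemLE_add_left (h : ReflTransGen (ElemLE S) N N') {k : ℕ}
    (hM : ∀ i ∈ M.support, (i : ℕ) < k) (hN : ∀ i ∈ N.support, k ≤ (i : ℕ))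
    (hN' : ∀ i ∈ N'.support, k ≤ (i : ℕ)) :
    ReflTransGen (ElemLE S) (M + N) (M + N') := by
  have key : ReflTransGen (ElemLE S) (M + N.filter fun i : Fin m => k ≤ (i : ℕ))
      (M + N'.filter fun i : Fin m => k ≤ (i : ℕ)) := by
    clear hN hN'
    induction h with
    | refl => exact .refl
    | tail _ h ih => exact ih.trans (h.add_left_filter hM)
  have hfilter : ∀ L : Fin m →₀ ℕ, (∀ i ∈ L.support, k ≤ (i : ℕ)) →
      (L.filter fun i : Fin m => k ≤ (i : ℕ)) = L := fun L hL =>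
    Finsupp.filter_eq_self_iff _ _ |>.2 fun i hi => hL i (Finsupp.mem_support_iff.2 hi)
  rwa [hfilter N hN, hfilter N' hN'] at key

theorem support_sum_single_subset {s : ℕ} (j : Fin s → Fin m) (a : Fin s → ℕ) {i : Fin m}
    (hi : i ∈ (∑ t, Finsupp.single (j t) (a t)).support) : ∃ t, i = j t := by
  obtain ⟨t, -, ht⟩ := Finset.mem_biUnion.1 (Finsupp.support_finsetSum hi)
  exact ⟨t, Finset.mem_singleton.1 (Finsupp.support_single_subset ht)⟩

/-- The last variable moves first, as all others lie below it. The others follow by induction and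
stay below `h (Fin.last s)`. -/
theorem reflTransGen_elemLE_shift {s : ℕ} {j h : Fin s → Fin m} (a : Fin s → ℕ)
    (hj : StrictMono j) (hh : StrictMono h) (hS : ∀ t, S (j t) = S (h t))
    (hjh : ∀ t, j t ≤ h t) :
    ReflTransGen (ElemLE S) (∑ t, Finsupp.single (j t) (a t))
      (∑ t, Finsupp.single (h t) (a t)) := by
  induction s with
  | zero => simpa using ReflTransGen.refl
  | succ s ih =>
    rw [Fin.sum_univ_castSucc, Fin.sum_univ_castSucc]
    have hcast : StrictMono (Fin.castSucc : Fin s → Fin (s + 1)) := Fin.strictMono_castSucc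
    refine ReflTransGen.trans (b := ∑ t : Fin s, Finsupp.single (j t.castSucc) (a t.castSucc) +
      Finsupp.single (h (Fin.last s)) (a (Fin.last s))) ?_
      (reflTransGen_elemLE_add_right (k := h (Fin.last s)) (ih _ (hj.comp hcast) (hh.comp hcast)
        (fun t => hS _) fun t => hjh _) (fun i hi => ?_) fun i hi => ?_)
    · rcases (hjh (Fin.last s)).eq_or_lt with heq | hlt
      · rw [heq]
      by_cases ha : a (Fin.last s) = 0
      · rw [ha, Finsupp.single_zero, Finsupp.single_zero]
      refine .single (.move _ _ _ _ hlt ha (hS _) fun l hl _ => ?_)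
      by_contra hl'
      obtain ⟨t, rfl⟩ := support_sum_single_subset _ _ (Finsupp.mem_support_iff.2 hl')
      exact absurd (hj (Fin.castSucc_lt_last t)) (not_lt.2 hl)
    · obtain ⟨t, rfl⟩ := support_sum_single_subset _ _ hi
      exact Fin.lt_def.1 (hh (Fin.castSucc_lt_last t))
    · rw [Finset.mem_singleton.1 (Finsupp.support_single_subset hi)]

theorem PolarLE.reflTransGen (h : PolarLE S M M') : ReflTransGen (ElemLE S) M M' := by
  induction h with
  | of_dvd h =>
    obtain ⟨N, rfl⟩ := exists_add_of_le h
    exact reflTransGen_elemLE_add _ _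
  | shift T j h a hj hh hSj hSh hjh =>
    exact reflTransGen_elemLE_shift a hj hh (fun t => (hSj t).trans (hSh t).symm) hjh
  | mul k hk hkm hM hM' hN hN' _ _ ih₁ ih₂ =>
    exact (reflTransGen_elemLE_add_right ih₁ hM' hN).trans
      (reflTransGen_elemLE_add_left ih₂ hM' hN hN')
  | trans _ _ ih₁ ih₂ => exact ih₁.trans ih₂

end Order

/-! ### Monotonicity of the Bhattacharyya parameter -/

section Main

variable {K Y : Type*} [Field K] [Fintype K] [DecidableEq K] [Fintype Y] {m : ℕ}
  {S : Fin m → Finset K} (e : ∀ k, Fin (S k).card ≃ S k) {W : K → Y → ℝ}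

/-- The row is found from the larger monomial downward: division lowers exponents, and a moved
exponent stays admissible because `S j = S h`. -/
theorem ElemLE.exists_row_le (hW : IsChannel W) (hsof : SymmetricOverField W)
    {M M' : Fin m →₀ ℕ} (h : ElemLE S M M') {i' : Fin (∏ k, (S k).card)}
    (hi' : rowMonomial (fun k => (S k).card) i' = M') :
    ∃ i, rowMonomial (fun k => (S k).card) i = M ∧
      synthBhattacharyya W (setPolarMatrix e) i ≤ synthBhattacharyya W (setPolarMatrix e) i' := by
  have hlt : ∀ k, M' k < (S k).card := fun k => hi' ▸ rowMonomial_lt i' k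
  cases h with
  | incr M k =>
    obtain ⟨i, hi⟩ := exists_rowMonomial_eq (n := fun k => (S k).card) (M := M)
      fun l => lt_of_le_of_lt (by simp) (hlt l)
    exact ⟨i, hi, synthBhattacharyya_le_of_add_single e hW hsof k (by rw [hi', hi])⟩
  | move B j h a hjh ha hS hB =>
    obtain ⟨i, hi⟩ := exists_rowMonomial_eq (n := fun k => (S k).card)
      (M := B + Finsupp.single j a) fun l => by
        by_cases hl : l = j
        · subst hl
          have := hlt h
          simp only [Finsupp.add_apply, Finsupp.single_eq_same, hB h hjh.le le_rfl,
            hB l le_rfl hjh.le] at this ⊢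
          rwa [hS]
        · refine lt_of_le_of_lt ?_ (hlt l)
          simp [Finsupp.single_apply, Ne.symm hl]
    exact ⟨i, hi, synthBhattacharyya_le_of_move e hW hsof hjh hS a hB hi hi'⟩

/-- If `M ⊴ M'`, then the synthetic channel of `M` is at least as good as that of `M'`. -/
theorem PolarLE.exists_row_le (hW : IsChannel W) (hsof : SymmetricOverField W)
    {M M' : Fin m →₀ ℕ} (h : PolarLE S M M') {i' : Fin (∏ k, (S k).card)}
    (hi' : rowMonomial (fun k => (S k).card) i' = M') :
    ∃ i, rowMonomial (fun k => (S k).card) i = M ∧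
      synthBhattacharyya W (setPolarMatrix e) i ≤ synthBhattacharyya W (setPolarMatrix e) i' := by
  have h' := h.reflTransGen
  clear h
  induction h' using Relation.ReflTransGen.head_induction_on with
  | refl => exact ⟨i', hi', le_rfl⟩
  | head h _ ih =>
    obtain ⟨i₁, hi₁, hle₁⟩ := ih
    obtain ⟨i, hi, hle⟩ := h.exists_row_le e hW hsof hi₁
    exact ⟨i, hi, hle.trans hle₁⟩

end Main

end PolarCode

theorem mainTheorem6 {K Y : Type*} [Field K] [Fintype K] [DecidableEq K] [Fintype Y]
    {m : ℕ} (S : Fin m → Finset K) (e : ∀ k, Fin (S k).card ≃ S k)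
    (W : K → Y → ℝ) (hW : PolarCode.IsChannel W) (hsof : PolarCode.SymmetricOverField W)
    (A : Set (Fin (∏ k, (S k).card)))
    (hA : PolarCode.IsInformationSet W (PolarCode.setPolarMatrix e) A)
    (M M' : Fin m →₀ ℕ)
    (hM : M ∈ PolarCode.monomialsOf (fun k => (S k).card) A)
    (hle : PolarCode.PolarLE S M' M)
    (hZ : ∀ i j : Fin (∏ k, (S k).card),
      PolarCode.rowMonomial (fun k => (S k).card) i = M →
      PolarCode.rowMonomial (fun k => (S k).card) j = M' →
      PolarCode.synthBhattacharyya W (PolarCode.setPolarMatrix e) j ≠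
        PolarCode.synthBhattacharyya W (PolarCode.setPolarMatrix e) i) :
    M' ∈ PolarCode.monomialsOf (fun k => (S k).card) A := by
  obtain ⟨i, hiA, hi⟩ := hM
  obtain ⟨j, hj, hji⟩ := hle.exists_row_le e hW hsof hi
  refine ⟨j, ?_, hj⟩
  by_contra hjA
  exact hZ i j hi hj (le_antisymm hji (hA i hiA j hjA))
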